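/- Let $(\Omega,\mu)$ be a probability space, let $S:\Omega\to\Omega$ be an invertible measurable map with measurable inverse for which $\mu$ is invariant and ergodic, and let $I=[0,1]$. For each $\vartheta\in\Omega$ let $f_\vartheta:I\to I$ be an orientation preserving homeomorphism of $I$ onto itself which is (one-sidedly) differentiable at $0$ and at $1$, such that $\vartheta\mapsto f_\vartheta(x)$ is measurable for every $x\in I$. Let $F:\Omega\times I\to\Omega\times I$, $F(\vartheta,x)=(S(\vartheta),f_\vartheta(x))$, and let $\pi_2:\Omega\times I\to I$ be the projection. Put $$\Lambda_0=\int_\Omega\log f_\vartheta'(0)\,d\mu(\vartheta),\qquad \Lambda_1=\int_\Omega\log f_\vartheta'(1)\,d\mu(\vartheta),$$ where $\log 0=-\infty$ and the integrals are understood as extended real numbers (the integral of the positive part minus the integral of the negative part, provided that not both are infinite). Assume that (I) $\Lambda_0$ and $\Lambda_1$ are well defined and $\Lambda_0,\Lambda_1>0$ (the value $+\infty$ is allowed); (II) either the set $\{f_\vartheta:\vartheta\in\Omega\}$ is finite, or all $f_\vartheta$ are diffeomorphisms of class $C^2$ of $I$ and there is a constant $C$ with $|f_\vartheta''(x)|/(f_\vartheta'(x))^2\le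 C$ for all $\vartheta\in\Omega$ and $x\in I$; (III) $F$ is essentially contracting: for almost every $\vartheta\in\Omega$ and all $x,y\in(0,1)$, $|\pi_2(F^n(\vartheta,x))-\pi_2(F^n(\vartheta,y))|\to0$ as $n\to\infty$. Then there exists a measurable function $\phi:\Omega\to(0,1)$ with the following properties: (a) for almost every $\vartheta\in\Omega$ and every $x\in I$, if $x<\phi(\vartheta)$ then $\lim_{n\to\infty}\pi_2(F^{-n}(\vartheta,x))=0$, and if $x>\phi(\vartheta)$ then $\lim_{n\to\infty}\pi_2(F^{-n}(\vartheta,x))=1$; (b) the graph of $\phi$ is $F$-invariant modulo null sets: there is a measurable set $E\subset\Omega$ with $\mu(E)=1$ and $S(E)=E$ such that $F$ maps $\{(\vartheta,\phi(\vartheta)):\vartheta\in E\}$ onto itself; (c) for almost every $\vartheta\in\Omega$ and every $x\in(0,1)$, $\lim_{n\to\infty}|\pi_2(F^n(\vartheta,x))-\phi(S^n(\vartheta))|=0$; (d) for almost every $\vartheta\in\Omega$, for every compact set $A\subset(0,1)$ and every $\varepsilon>0$ there exists $N$ such that for every $n\ge N$ $$\pi_2\big(F^n(\{S^{-n}(\vartheta)\}\times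 A)\big)\subset(\phi(\vartheta)-\varepsilon,\phi(\vartheta)+\varepsilon);$$ (e) if $\Omega$ is a compact metric space with its Borel $\sigma$-algebra and $F$ is continuous, then for almost every $\vartheta\in\Omega$ and every $x\in(0,1)$ the measures $\frac1n\sum_{k=0}^{n-1}F^k_*(\delta_{(\vartheta,x)})$ converge, as $n\to\infty$, in the weak-$*$ topology to the measure $\mu_\phi$ given by $\mu_\phi(A)=\mu\{\vartheta\in\Omega:(\vartheta,\phi(\vartheta))\in A\}$. -/

import Mathlib

open MeasureTheory Filter Topology

noncomputable section

namespace IntervalSkew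

variable {Ω : Type*}

/-- The skew product `F (ϑ, x) = (S ϑ, f ϑ x)` on `Ω × [0,1]`. It is a bijection, with inverse
`(ϑ, x) ↦ (S⁻¹ ϑ, (f (S⁻¹ ϑ))⁻¹ x)`, since the base map and all fibre maps are bijections. -/
def skewProduct [MeasurableSpace Ω] (S : Ω ≃ᵐ Ω) (f : Ω → unitInterval ≃ₜ unitInterval) :
    Ω × unitInterval ≃ Ω × unitInterval where
  toFun p := (S p.1, f p.1 p.2)
  invFun p := (S.symm p.1, (f (S.symm p.1)).symm p.2)
  left_inv p := by simp
  right_inv p := by simp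

/-- A self-map of `[0,1]` as a real function on `ℝ` (constant on either side of `[0,1]`; it is only
ever differentiated within `[0,1]`). -/
def realMap (g : unitInterval → unitInterval) : ℝ → ℝ :=
  Set.IccExtend (zero_le_one : (0 : ℝ) ≤ 1) (fun x => (g x : ℝ))

/-- The derivative of a self-map of `[0,1]`, one-sided at the endpoints. -/
def fibreDeriv (g : unitInterval → unitInterval) : ℝ → ℝ :=
  derivWithin (realMap g) (Set.Icc 0 1)

/-- The second derivative of a self-map of `[0,1]`, one-sided at the endpoints. -/
def fibreDeriv₂ (g : unitInterval → unitInterval) : ℝ → ℝ :=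
  derivWithin (fibreDeriv g) (Set.Icc 0 1)

/-- Differentiability of a self-map of `[0,1]` at the point `a`, one-sided at the endpoints. -/
def FibreDifferentiableAt (g : unitInterval → unitInterval) (a : ℝ) : Prop :=
  DifferentiableWithinAt ℝ (realMap g) (Set.Icc 0 1) a

/-- A homeomorphism of `[0,1]` that is a diffeomorphism of class `C²`. -/
def IsC2Diffeo (g : unitInterval ≃ₜ unitInterval) : Prop :=
  ContDiffOn ℝ 2 (realMap g) (Set.Icc 0 1) ∧ ContDiffOn ℝ 2 (realMap g.symm) (Set.Icc 0 1)

/-- `log (f_ϑ' a)` as an extended real; it is `-∞` where the derivative vanishes. -/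
def logDeriv (f : Ω → unitInterval ≃ₜ unitInterval) (a : ℝ) (ϑ : Ω) : EReal :=
  ENNReal.log (ENNReal.ofReal (fibreDeriv (f ϑ) a))

/-- The fibrewise Lyapunov exponent `∫ log (f_ϑ' a) dμ` at the level `a ∈ {0, 1}`, as an extended
real: the integral of the positive part minus the integral of the negative part. If both are
infinite, the integral is undefined and the value here is `⊤ - ⊤ = ⊥`. -/
def exponent [MeasurableSpace Ω] (μ : Measure Ω) (f : Ω → unitInterval ≃ₜ unitInterval) (a : ℝ) :
    EReal :=
  ((∫⁻ ϑ, (logDeriv f a ϑ).toENNReal ∂μ : ENNReal) : EReal)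
    - ((∫⁻ ϑ, (-logDeriv f a ϑ).toENNReal ∂μ : ENNReal) : EReal)

/-- For a.e. `ϑ` the distance of any two points of `{ϑ} × (0,1)` tends to `0` under iteration. -/
def EssentiallyContracting [MeasurableSpace Ω] (μ : Measure Ω)
    (F : Ω × unitInterval → Ω × unitInterval) : Prop :=
  ∀ᵐ ϑ ∂μ, ∀ x ∈ Set.Ioo (0 : unitInterval) 1, ∀ y ∈ Set.Ioo (0 : unitInterval) 1,
    Tendsto (fun n : ℕ => |((F^[n] (ϑ, x)).2 : ℝ) - ((F^[n] (ϑ, y)).2 : ℝ)|) atTop (𝓝 0)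

/-- The graph of `φ` over the set `E`. -/
def graphOver (φ : Ω → unitInterval) (E : Set Ω) : Set (Ω × unitInterval) :=
  (fun ϑ => (ϑ, φ ϑ)) '' E

/-- The graph of `φ` is invariant modulo null sets: over some `S`-invariant measurable set `E` of
full measure, the skew product maps the graph of `φ` onto itself. -/
def GraphInvariant [MeasurableSpace Ω] (μ : Measure Ω) (S : Ω ≃ᵐ Ω)
    (f : Ω → unitInterval ≃ₜ unitInterval) (φ : Ω → unitInterval) : Prop :=
  ∃ E : Set Ω, MeasurableSet E ∧ μ Eᶜ = 0 ∧ S '' E = E ∧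
    skewProduct S f '' graphOver φ E = graphOver φ E

/-- The measure `μ_ψ` on the graph of `ψ`: `μ_ψ A = μ {ϑ | (ϑ, ψ ϑ) ∈ A}`. -/
def graphMeasure [MeasurableSpace Ω] (μ : Measure Ω) (ψ : Ω → unitInterval) :
    Measure (Ω × unitInterval) :=
  μ.map (fun ϑ => (ϑ, ψ ϑ))

/-- The measure `(1/n) ∑_{k<n} F^k_* δ_p`. -/
def empiricalMeasure {X : Type*} [MeasurableSpace X] (F : X → X) (p : X) (n : ℕ) : Measure X :=
  (n : ENNReal)⁻¹ • ∑ k ∈ Finset.range n, (Measure.dirac p).map (F^[k])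

/-- Weak-* convergence of a sequence of measures on a (compact) space, tested against the
continuous real functions. -/
def WeakStarTendsto {X : Type*} [TopologicalSpace X] [MeasurableSpace X]
    (ν : ℕ → Measure X) (ν₀ : Measure X) : Prop :=
  ∀ h : C(X, ℝ), Tendsto (fun n => ∫ p, h p ∂(ν n)) atTop (𝓝 (∫ p, h p ∂ν₀))

end IntervalSkew

end

/-!
The two levels `0` and `1` are repelling for the skew product `F`, hence attracting for `F⁻¹`, and
`φ` is the common boundary of their basins under backward iteration.

In the fibre over `ϑ`, the backward basin of `0` is an initial segment of the interval and that of
`1` a final one; `lowerBoundary` and `upperBoundary` denote their ends. Both are measurable, and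
both are invariant sections at every `ϑ`, since `F` maps basins onto basins.

*The basins are nontrivial* (`ae_exists_ball_subset_backwardBasin`). The regularity hypothesis makes
all fibre maps expand distances to a fixed level `a` by `(f_ϑ)' a`, up to a factor `exp (-ε)`, on
neighbourhoods whose images have a common size (`exists_uniform_expansion`): for finitely many maps
this is the definition of the derivative, and for `C²` maps the bound on `|f''| / (f')²` says that
`|(log f')'| ≤ C f'`, so that distortion is controlled by the distance of the images. The factors
met by a backward orbit near `a` multiply to `exp` of minus a Birkhoff sum of `log (f_ϑ)' a - ε`.
As the integral is positive for small `ε` (after truncation, `exists_integrable_le_of_pos`), these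
sums tend to infinity almost surely, so a backward orbit that starts close enough to `a` never
leaves the region where the estimate holds, and tends to `a`.

*The boundaries coincide.* Both lie in the open interval, so by essential contraction their distance
tends to `0` along forward orbits. By invariance this distance is a function on the base evaluated
along the orbit of `S`, and a measure preserving map cannot push a function to `0` unless it is `0`
almost everywhere (`ae_eq_zero_of_tendsto_iterate`).

With `φ` the common value, separation and invariance hold by construction, forward attraction is
essential contraction applied to the point `φ ϑ`, and pullback attraction follows from separation by
monotonicity. For the empirical measures, the orbit of `(ϑ, x)` is asymptotic to that of
`(ϑ, φ ϑ)`, along which Birkhoff's theorem applies to a countable dense set of continuous functions.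

Birkhoff's theorem (`ae_tendsto_birkhoffSum_div`) is deduced from the fact that Birkhoff sums of a
function with negative integral are almost surely bounded above (`ae_bddAbove_birkhoffSum`).
-/

open MeasureTheory Filter Topology

noncomputable section

namespace IntervalSkew

/-! ### Birkhoff's ergodic theorem -/

/-- The running maximum `max_{k ≤ n} birkhoffSum T h k` of the Birkhoff sums, defined by the
recursion `M (n + 1) = max 0 (h + M n ∘ T)` that the argument uses. -/
def birkhoffMax {α : Type*} (T : α → α) (h : α → ℝ) : ℕ → α → ℝ
  | 0, _ => 0
  | n + 1, x => max 0 (h x + birkhoffMax T h n (T x))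

section Birkhoff

variable {α : Type*} {T : α → α} {h : α → ℝ}

theorem birkhoffSum_le_birkhoffMax (n : ℕ) (x : α) :
    birkhoffSum T h n x ≤ birkhoffMax T h n x := by
  induction n generalizing x with
  | zero => simp [birkhoffMax]
  | succ n ih =>
    rw [birkhoffSum_succ', birkhoffMax]
    exact le_max_of_le_right (by linarith [ih (T x)])

theorem birkhoffMax_nonneg (n : ℕ) (x : α) : 0 ≤ birkhoffMax T h n x := by
  cases n with
  | zero => exact le_rfl
  | succ n => exact le_max_left _ _

theorem birkhoffMax_le_succ (n : ℕ) (x : α) :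
    birkhoffMax T h n x ≤ birkhoffMax T h (n + 1) x := by
  induction n generalizing x with
  | zero => exact birkhoffMax_nonneg 1 x
  | succ n ih =>
    rw [birkhoffMax, birkhoffMax]
    exact max_le_max le_rfl (by linarith [ih (T x)])

theorem birkhoffMax_mono (x : α) : Monotone fun n => birkhoffMax T h n x :=
  monotone_nat_of_le_succ fun n => birkhoffMax_le_succ n x

theorem birkhoffMax_succ_sub (n : ℕ) (x : α) :
    birkhoffMax T h (n + 1) x - birkhoffMax T h n (T x)
      = max (-birkhoffMax T h n (T x)) (h x) := by
  rw [birkhoffMax, ← max_sub_sub_right]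
  ring_nf

theorem abs_birkhoffMax_succ_sub_le (n : ℕ) (x : α) :
    |birkhoffMax T h (n + 1) x - birkhoffMax T h n (T x)| ≤ |h x| := by
  rw [birkhoffMax_succ_sub, abs_le]
  have := birkhoffMax_nonneg (T := T) (h := h) n (T x)
  exact ⟨le_max_of_le_right (neg_abs_le _),
    max_le (by linarith [abs_nonneg (h x)]) (le_abs_self _)⟩

theorem bddAbove_birkhoffMax_comp_iff (x : α) :
    BddAbove (Set.range fun n => birkhoffMax T h n (T x)) ↔
      BddAbove (Set.range fun n => birkhoffMax T h n x) := by
  constructor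
  · rintro ⟨K, hK⟩
    refine ⟨max 0 (h x + K), ?_⟩
    rintro _ ⟨n, rfl⟩
    refine (birkhoffMax_le_succ n x).trans ?_
    have := hK ⟨n, rfl⟩
    exact max_le_max le_rfl (by simpa using this)
  · rintro ⟨K, hK⟩
    refine ⟨K - h x, ?_⟩
    rintro _ ⟨n, rfl⟩
    have h1 : birkhoffMax T h (n + 1) x ≤ K := hK ⟨n + 1, rfl⟩
    have h2 : h x + birkhoffMax T h n (T x) ≤ birkhoffMax T h (n + 1) x := le_max_right _ _
    change birkhoffMax T h n (T x) ≤ K - h x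
    linarith

theorem birkhoffSum_sub_const (g : α → ℝ) (c : ℝ) (n : ℕ) (x : α) :
    birkhoffSum T (fun y => g y - c) n x = birkhoffSum T g n x - n * c := by
  simp [birkhoffSum, Finset.sum_sub_distrib]

variable [MeasurableSpace α] {μ : Measure α}

theorem measurable_birkhoffMax (hT : Measurable T) (hm : Measurable h) (n : ℕ) :
    Measurable (birkhoffMax T h n) := by
  induction n with
  | zero => exact measurable_const
  | succ n ih => exact measurable_const.max (hm.add (ih.comp hT))

theorem integrable_birkhoffMax (hT : MeasurePreserving T μ μ) (hi : Integrable h μ) (n : ℕ) :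
    Integrable (birkhoffMax T h n) μ := by
  induction n with
  | zero => exact integrable_zero _ _ _
  | succ n ih =>
    exact (integrable_zero _ _ _).sup (hi.add (hT.integrable_comp_of_integrable ih))

/-- The maximal inequality in qualitative form: the Birkhoff sums of a function with negative
integral are almost surely bounded above. Otherwise, by ergodicity, the running maxima `M n` tend
to infinity almost everywhere, so that `M (n + 1) - M n ∘ T = max (-M n ∘ T) h` decreases to `h`;
but the integral of the left-hand side is nonnegative. -/
theorem ae_bddAbove_birkhoffSum (hT : Ergodic T μ) (hm : Measurable h) (hi : Integrable h μ)
    (hneg : ∫ x, h x ∂μ < 0) :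
    ∀ᵐ x ∂μ, BddAbove (Set.range fun n => birkhoffSum T h n x) := by
  have hTm := hT.measurable
  have hmeas : MeasurableSet {x | BddAbove (Set.range fun n => birkhoffMax T h n x)} :=
    measurableSet_bddAbove_range fun n => measurable_birkhoffMax hTm hm n
  have hinv : T ⁻¹' {x | BddAbove (Set.range fun n => birkhoffMax T h n x)}
      = {x | BddAbove (Set.range fun n => birkhoffMax T h n x)} := by
    ext x
    exact bddAbove_birkhoffMax_comp_iff x
  rcases hT.toPreErgodic.ae_mem_or_ae_notMem hmeas hinv with hb | hb
  · filter_upwards [hb] with x hx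
    obtain ⟨K, hK⟩ := hx
    refine ⟨K, ?_⟩
    rintro _ ⟨n, rfl⟩
    exact (birkhoffSum_le_birkhoffMax n x).trans (hK ⟨n, rfl⟩)
  · exfalso
    have hlim : Tendsto (fun n => ∫ x, (birkhoffMax T h (n + 1) x - birkhoffMax T h n (T x)) ∂μ)
        atTop (𝓝 (∫ x, h x ∂μ)) := by
      refine tendsto_integral_of_dominated_convergence (fun x => |h x|) (fun n => ?_) hi.abs
        (fun n => ae_of_all _ fun x => abs_birkhoffMax_succ_sub_le n x) ?_
      · exact ((measurable_birkhoffMax hTm hm _).sub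
          ((measurable_birkhoffMax hTm hm n).comp hTm)).aestronglyMeasurable
      · filter_upwards [hb] with x hx
        have hx' : ¬ BddAbove (Set.range fun n => birkhoffMax T h n (T x)) := fun H =>
          hx ((bddAbove_birkhoffMax_comp_iff x).1 H)
        have htop := tendsto_atTop_atTop_of_monotone' (birkhoffMax_mono (T x)) hx'
        refine tendsto_const_nhds.congr' ?_
        filter_upwards [htop.eventually_ge_atTop (-h x)] with n hn
        rw [birkhoffMax_succ_sub, max_eq_right (by linarith)]
    have hge : ∀ n, 0 ≤ ∫ x, (birkhoffMax T h (n + 1) x - birkhoffMax T h n (T x)) ∂μ := by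
      intro n
      have hn := integrable_birkhoffMax hT.toMeasurePreserving hi n
      have hn' := integrable_birkhoffMax hT.toMeasurePreserving hi (n + 1)
      have hcomp : ∫ x, birkhoffMax T h n (T x) ∂μ = ∫ x, birkhoffMax T h n x ∂μ := by
        conv_rhs => rw [← hT.map_eq]
        rw [integral_map hTm.aemeasurable
          (measurable_birkhoffMax hTm hm n).aestronglyMeasurable]
      have hn'' : Integrable (fun x => birkhoffMax T h n (T x)) μ :=
        hT.toMeasurePreserving.integrable_comp_of_integrable hn
      rw [integral_sub hn' hn'', hcomp, sub_nonneg]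
      exact integral_mono hn hn' fun x => birkhoffMax_le_succ n x
    exact absurd (ge_of_tendsto' hlim hge) (not_le.2 hneg)

variable [IsProbabilityMeasure μ] {g : α → ℝ}

theorem ae_exists_birkhoffSum_le (hT : Ergodic T μ) (hm : Measurable g) (hi : Integrable g μ)
    {c : ℝ} (hc : ∫ x, g x ∂μ < c) :
    ∀ᵐ x ∂μ, ∃ K : ℝ, ∀ n : ℕ, birkhoffSum T g n x ≤ n * c + K := by
  have := ae_bddAbove_birkhoffSum (h := fun y => g y - c) hT (hm.sub_const c)
    (hi.sub (integrable_const c)) (by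
      rw [integral_sub hi (integrable_const c)]
      simpa using hc)
  filter_upwards [this] with x ⟨K, hK⟩
  refine ⟨K, fun n => ?_⟩
  have := hK ⟨n, rfl⟩
  simp only [birkhoffSum_sub_const] at this
  linarith

theorem ae_exists_le_birkhoffSum (hT : Ergodic T μ) (hm : Measurable g) (hi : Integrable g μ)
    {c : ℝ} (hc : c < ∫ x, g x ∂μ) :
    ∀ᵐ x ∂μ, ∃ K : ℝ, ∀ n : ℕ, n * c - K ≤ birkhoffSum T g n x := by
  have := ae_exists_birkhoffSum_le (g := -g) hT hm.neg hi.neg (c := -c) (by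
    simp only [Pi.neg_apply, integral_neg]; linarith)
  filter_upwards [this] with x ⟨K, hK⟩
  refine ⟨K, fun n => ?_⟩
  have := hK n
  rw [birkhoffSum_neg] at this
  linarith

/-- The Birkhoff sums of a function with positive integral tend to infinity. -/
theorem ae_tendsto_birkhoffSum_atTop (hT : Ergodic T μ) (hm : Measurable g)
    (hi : Integrable g μ) (hpos : 0 < ∫ x, g x ∂μ) :
    ∀ᵐ x ∂μ, Tendsto (fun n => birkhoffSum T g n x) atTop atTop := by
  filter_upwards [ae_exists_le_birkhoffSum hT hm hi (half_lt_self hpos)] with x ⟨K, hK⟩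
  refine tendsto_atTop_mono hK ?_
  exact tendsto_atTop_add_const_right _ _
    (tendsto_natCast_atTop_atTop.atTop_mul_const (half_pos hpos))

/-- Birkhoff's pointwise ergodic theorem for an ergodic map of a probability space. -/
theorem ae_tendsto_birkhoffSum_div (hT : Ergodic T μ) (hm : Measurable g)
    (hi : Integrable g μ) :
    ∀ᵐ x ∂μ, Tendsto (fun n : ℕ => birkhoffSum T g n x / n) atTop (𝓝 (∫ x, g x ∂μ)) := by
  have hup : ∀ᵐ x ∂μ, ∀ k : ℕ, ∃ K : ℝ, ∀ n : ℕ,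
      birkhoffSum T g n x ≤ n * (∫ x, g x ∂μ + 1 / (k + 1)) + K :=
    ae_all_iff.2 fun k => ae_exists_birkhoffSum_le hT hm hi
      (lt_add_of_pos_right _ Nat.one_div_pos_of_nat)
  have hlow : ∀ᵐ x ∂μ, ∀ k : ℕ, ∃ K : ℝ, ∀ n : ℕ,
      n * (∫ x, g x ∂μ - 1 / (k + 1)) - K ≤ birkhoffSum T g n x :=
    ae_all_iff.2 fun k => ae_exists_le_birkhoffSum hT hm hi
      (sub_lt_self _ Nat.one_div_pos_of_nat)
  filter_upwards [hup, hlow] with x hx hx'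
  rw [Metric.tendsto_atTop']
  intro ε hε
  obtain ⟨k, hk⟩ := exists_nat_one_div_lt (half_pos hε)
  obtain ⟨K, hK⟩ := hx k
  obtain ⟨K', hK'⟩ := hx' k
  obtain ⟨N, hN⟩ := exists_nat_gt (max K K' / (ε / 2))
  refine ⟨N, fun n hn => ?_⟩
  have hn0 : (0 : ℝ) < n := by exact_mod_cast (Nat.zero_le N).trans_lt hn
  have hmax : max K K' < n * (ε / 2) := by
    have : max K K' / (ε / 2) < n := hN.trans (by exact_mod_cast hn)
    rwa [div_lt_iff₀ (half_pos hε)] at this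
  have hk' : n * (1 / ((k : ℝ) + 1)) ≤ n * (ε / 2) := by gcongr
  have h1 := hK n
  have h2 := hK' n
  have h3 := le_max_left K K'
  have h4 := le_max_right K K'
  rw [Real.dist_eq, div_sub' hn0.ne', abs_div, abs_of_pos hn0, div_lt_iff₀ hn0, abs_lt]
  constructor <;> linarith

end Birkhoff

/-! ### Extended real integrals -/

/-- A function whose extended real integral is positive dominates an integrable real function with
positive integral, obtained by truncating the positive part. -/
theorem exists_integrable_le_of_pos {α : Type*} [MeasurableSpace α] {μ : Measure α}
    [IsFiniteMeasure μ] {L : α → EReal} (hL : Measurable L)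
    (hpos : 0 < ((∫⁻ x, (L x).toENNReal ∂μ : ENNReal) : EReal)
      - ((∫⁻ x, (-L x).toENNReal ∂μ : ENNReal) : EReal)) :
    ∃ a : α → ℝ, Measurable a ∧ Integrable a μ ∧ (∀ᵐ x ∂μ, (a x : EReal) ≤ L x) ∧
      0 < ∫ x, a x ∂μ := by
  set P := fun x => (L x).toENNReal with hP
  set N := fun x => (-L x).toENNReal with hN
  have hPm : Measurable P := hL.ereal_toENNReal
  have hNm : Measurable N := hL.neg.ereal_toENNReal
  have hNP : ∫⁻ x, N x ∂μ < ∫⁻ x, P x ∂μ := by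
    rw [← EReal.coe_ennreal_lt_coe_ennreal_iff]
    exact EReal.sub_pos.1 hpos
  have hNtop : ∫⁻ x, N x ∂μ ≠ ⊤ := (hNP.trans_le le_top).ne
  have hsup : ∫⁻ x, P x ∂μ = ⨆ n : ℕ, ∫⁻ x, min (P x) n ∂μ := by
    rw [← lintegral_iSup (fun n => hPm.min measurable_const)
      (fun m n hmn x => min_le_min le_rfl (by exact_mod_cast hmn))]
    congr 1 with x
    rw [← inf_iSup_eq, ENNReal.iSup_natCast, inf_top_eq]
  rw [hsup, lt_iSup_iff] at hNP
  obtain ⟨n, hn⟩ := hNP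
  have hQtop : ∫⁻ x, min (P x) n ∂μ ≠ ⊤ := by
    refine ((lintegral_mono fun x => min_le_right (P x) (n : ENNReal)).trans_lt ?_).ne
    rw [lintegral_const]
    exact ENNReal.mul_lt_top (ENNReal.natCast_lt_top n) (measure_lt_top _ _)
  have hQm : Measurable fun x => min (P x) (n : ENNReal) := hPm.min measurable_const
  have hNfin : ∀ᵐ x ∂μ, N x < ⊤ := ae_lt_top hNm hNtop
  have hQfin : ∀ x, min (P x) (n : ENNReal) < ⊤ := fun x =>
    (min_le_right _ _).trans_lt (ENNReal.natCast_lt_top n)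
  have hQi := integrable_toReal_of_lintegral_ne_top hQm.aemeasurable hQtop
  have hNi := integrable_toReal_of_lintegral_ne_top hNm.aemeasurable hNtop
  refine ⟨fun x => (min (P x) n).toReal - (N x).toReal, hQm.ennreal_toReal.sub
    hNm.ennreal_toReal, hQi.sub hNi, ?_, ?_⟩
  · filter_upwards [hNfin] with x hx
    rcases le_total 0 (L x) with h0 | h0
    · have hN0 : N x = 0 := EReal.toENNReal_of_nonpos (by simpa using h0)
      rw [hN0, ENNReal.toReal_zero, sub_zero]
      calc (((min (P x) n).toReal : ℝ) : EReal) = ((min (P x) n : ENNReal) : EReal) :=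
            EReal.coe_ennreal_toReal (hQfin x).ne
        _ ≤ ((P x : ENNReal) : EReal) := EReal.coe_ennreal_le_coe_ennreal_iff.2 (min_le_left _ _)
        _ = L x := EReal.coe_toENNReal h0
    · have hP0 : P x = 0 := EReal.toENNReal_of_nonpos h0
      rw [hP0]
      simp only [zero_le, inf_of_le_left, ENNReal.toReal_zero, zero_sub]
      rw [EReal.coe_neg, EReal.coe_ennreal_toReal hx.ne,
        EReal.coe_toENNReal (by simpa using EReal.neg_le_neg_iff.2 h0), neg_neg]
  · rw [integral_sub hQi hNi, integral_toReal hQm.aemeasurable (ae_of_all _ hQfin),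
      integral_toReal hNm.aemeasurable hNfin, sub_pos]
    exact (ENNReal.toReal_lt_toReal hNtop hQtop).2 hn

/-! ### Derivatives of the fibre maps -/

theorem realMap_coe (g : unitInterval → unitInterval) (x : unitInterval) :
    realMap g x = g x :=
  Set.IccExtend_val _ _ x

theorem realMap_monotone {g : unitInterval → unitInterval} (hg : Monotone g) :
    Monotone (realMap g) := by
  refine Monotone.IccExtend _ ?_
  exact fun x y hxy => hg hxy

theorem fibreDeriv_nonneg {g : unitInterval → unitInterval} (hg : Monotone g) (x : ℝ) :
    0 ≤ fibreDeriv g x :=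
  ((realMap_monotone hg).monotoneOn _).derivWithin_nonneg

theorem FibreDifferentiableAt.tendsto_slope {g : unitInterval → unitInterval} {a : unitInterval}
    (hg : FibreDifferentiableAt g a) :
    Tendsto (fun x : unitInterval => ((g x : ℝ) - g a) / (x - a)) (𝓝[≠] a)
      (𝓝 (fibreDeriv g a)) := by
  have h := hasDerivWithinAt_iff_tendsto_slope.1 (DifferentiableWithinAt.hasDerivWithinAt hg)
  have hval : Tendsto (Subtype.val : unitInterval → ℝ) (𝓝[≠] a)
      (𝓝[Set.Icc 0 1 \ {(a : ℝ)}] a) := by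
    refine tendsto_nhdsWithin_iff.2 ⟨tendsto_nhdsWithin_of_tendsto_nhds
      continuous_subtype_val.continuousAt, ?_⟩
    filter_upwards [self_mem_nhdsWithin] with x hx
    exact ⟨x.2, fun hxa => hx (Subtype.ext hxa)⟩
  refine (h.comp hval).congr fun x => ?_
  simp only [Function.comp, slope_def_field, realMap_coe]

theorem measurable_fibreDeriv {Ω : Type*} [MeasurableSpace Ω]
    {f : Ω → unitInterval ≃ₜ unitInterval} (hmeas : ∀ x, Measurable fun ϑ => f ϑ x)
    {a : unitInterval} (hdiff : ∀ ϑ, FibreDifferentiableAt (f ϑ) a) :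
    Measurable fun ϑ => fibreDeriv (f ϑ) a := by
  refine measurable_of_tendsto_metrizable' (𝓝[≠] a)
    (f := fun (x : unitInterval) ϑ => ((f ϑ x : ℝ) - f ϑ a) / (x - a)) (fun x => ?_)
    (tendsto_pi_nhds.2 fun ϑ => (hdiff ϑ).tendsto_slope)
  exact ((hmeas x).subtype_val.sub (hmeas a).subtype_val).div_const _

/-- A homeomorphism of the interval with positive derivative at `a` expands distances to `a` by
almost the factor `g' a`, as long as the image point stays close to `g a`. -/
theorem eventually_expanding (g : unitInterval ≃ₜ unitInterval) {a : unitInterval}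
    (hg : FibreDifferentiableAt g a) (ha : 0 < fibreDeriv g a) {ε : ℝ} (hε : 0 < ε) :
    ∀ᶠ δ in 𝓝[>] (0 : ℝ), ∀ x, dist (g x) (g a) < δ →
      dist x a * fibreDeriv g a ≤ dist (g x) (g a) * Real.exp ε := by
  have hlt : fibreDeriv g a * Real.exp (-ε) < fibreDeriv g a :=
    mul_lt_of_lt_one_right ha (by simpa using hε)
  have hslope : ∀ᶠ x in 𝓝 a, x ≠ a →
      fibreDeriv g a * Real.exp (-ε) < ((g x : ℝ) - g a) / (x - a) :=
    eventually_nhdsWithin_iff.1 (hg.tendsto_slope.eventually_const_lt hlt)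
  have hexp : ∀ᶠ x in 𝓝 a, dist x a * fibreDeriv g a ≤ dist (g x) (g a) * Real.exp ε := by
    filter_upwards [hslope] with x hx
    by_cases hxa : x = a
    · simp [hxa]
    · have h := (hx hxa).le.trans (le_abs_self _)
      have hd : (0 : ℝ) < |(x : ℝ) - a| :=
        abs_pos.2 (sub_ne_zero.2 fun h => hxa (Subtype.ext h))
      rw [abs_div, le_div_iff₀ hd, Real.exp_neg] at h
      rw [Subtype.dist_eq, Subtype.dist_eq, Real.dist_eq, Real.dist_eq]
      calc |(x : ℝ) - a| * fibreDeriv g a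
          = fibreDeriv g a * (Real.exp ε)⁻¹ * |(x : ℝ) - a| * Real.exp ε := by
            field_simp
        _ ≤ _ := by gcongr
  have hinv : ∀ᶠ y in 𝓝 (g a), dist (g.symm y) a * fibreDeriv g a
      ≤ dist y (g a) * Real.exp ε := by
    have := (g.symm.continuous.tendsto (g a))
    rw [g.symm_apply_apply] at this
    filter_upwards [this.eventually hexp] with y hy
    simpa using hy
  obtain ⟨δ, hδ, hball⟩ := Metric.eventually_nhds_iff.1 hinv
  filter_upwards [Ioo_mem_nhdsGT hδ] with δ' hδ' x hx
  simpa using hball (hx.trans hδ'.2)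

theorem IsC2Diffeo.differentiableOn {g : unitInterval ≃ₜ unitInterval} (hg : IsC2Diffeo g) :
    DifferentiableOn ℝ (realMap g) (Set.Icc 0 1) :=
  hg.1.differentiableOn (by norm_num)

theorem IsC2Diffeo.fibreDeriv_pos {g : unitInterval ≃ₜ unitInterval} (hg : IsC2Diffeo g)
    (hmono : Monotone g) {x : ℝ} (hx : x ∈ Set.Icc (0 : ℝ) 1) : 0 < fibreDeriv g x := by
  refine (fibreDeriv_nonneg hmono x).lt_of_ne' fun h0 => ?_
  have hmaps : Set.MapsTo (realMap g) (Set.Icc 0 1) (Set.Icc 0 1) := fun y hy => by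
    rw [show y = ((⟨y, hy⟩ : unitInterval) : ℝ) from rfl, realMap_coe]
    exact (g ⟨y, hy⟩).2
  have hinv : ∀ y ∈ Set.Icc (0 : ℝ) 1, (realMap g.symm ∘ realMap g) y = y := fun y hy => by
    rw [show y = ((⟨y, hy⟩ : unitInterval) : ℝ) from rfl, Function.comp_apply, realMap_coe,
      realMap_coe, g.symm_apply_apply]
  have h1 := (hg.differentiableOn x hx).hasDerivWithinAt
  have h2 := ((hg.2.differentiableOn (by norm_num)) _ (hmaps hx)).hasDerivWithinAt
  have h3 := (h2.comp x h1 hmaps).congr_of_mem (fun y hy => (hinv y hy).symm) hx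
  have h4 : HasDerivWithinAt (fun y : ℝ => y) 1 (Set.Icc 0 1) x := hasDerivWithinAt_id _ _
  have h5 := (uniqueDiffOn_Icc zero_lt_one x hx).eq_deriv _ h3 h4
  rw [show derivWithin (realMap g) (Set.Icc 0 1) x = 0 from h0, mul_zero] at h5
  exact zero_ne_one h5

/-- The condition `|g''| / (g')² ≤ C` bounds the derivative of `log g'` by `C g'`, and hence the
distortion of `g` between two points by the distance of their images. -/
theorem IsC2Diffeo.abs_log_fibreDeriv_sub_le {g : unitInterval ≃ₜ unitInterval}
    (hg : IsC2Diffeo g) (hmono : Monotone g) {C : ℝ}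
    (hC : ∀ x ∈ Set.Icc (0 : ℝ) 1, |fibreDeriv₂ g x| / (fibreDeriv g x) ^ 2 ≤ C)
    {x y : ℝ} (hx : x ∈ Set.Icc (0 : ℝ) 1) (hy : y ∈ Set.Icc (0 : ℝ) 1) :
    |Real.log (fibreDeriv g x) - Real.log (fibreDeriv g y)|
      ≤ C * |realMap g x - realMap g y| := by
  wlog hxy : y ≤ x generalizing x y
  · rw [abs_sub_comm, abs_sub_comm (realMap g x)]
    exact this hy hx (le_of_not_ge hxy)
  have hD : DifferentiableOn ℝ (fibreDeriv g) (Set.Icc 0 1) :=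
    (hg.1.derivWithin (m := 1) (uniqueDiffOn_Icc zero_lt_one) (by norm_num)).differentiableOn
      (by norm_num)
  have hlogc : ContinuousOn (fun z => Real.log (fibreDeriv g z)) (Set.Icc 0 1) :=
    hD.continuousOn.log fun z hz => (hg.fibreDeriv_pos hmono hz).ne'
  have hmulc : ContinuousOn (fun z => C * realMap g z) (Set.Icc 0 1) :=
    hg.differentiableOn.continuousOn.const_mul C
  have hlogd : ∀ z ∈ interior (Set.Icc (0 : ℝ) 1),
      HasDerivWithinAt (fun z => Real.log (fibreDeriv g z)) (fibreDeriv₂ g z / fibreDeriv g z)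
        (interior (Set.Icc 0 1)) z := fun z hz =>
    ((hD z (interior_subset hz)).hasDerivWithinAt.log
      (hg.fibreDeriv_pos hmono (interior_subset hz)).ne').mono interior_subset
  have hmuld : ∀ z ∈ interior (Set.Icc (0 : ℝ) 1),
      HasDerivWithinAt (fun z => C * realMap g z) (C * fibreDeriv g z)
        (interior (Set.Icc 0 1)) z := fun z hz =>
    ((hg.differentiableOn z (interior_subset hz)).hasDerivWithinAt.const_mul C).mono
      interior_subset
  have hbound : ∀ z ∈ interior (Set.Icc (0 : ℝ) 1),
      |fibreDeriv₂ g z / fibreDeriv g z| ≤ C * fibreDeriv g z := fun z hz => by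
    have hpos := hg.fibreDeriv_pos hmono (interior_subset hz)
    have h := hC z (interior_subset hz)
    rw [div_le_iff₀ (by positivity)] at h
    rw [abs_div, abs_of_pos hpos, div_le_iff₀ hpos]
    linarith
  have h1 := monotoneOn_of_hasDerivWithinAt_nonneg (convex_Icc (0 : ℝ) 1) (hmulc.add hlogc)
    (fun z hz => (hmuld z hz).add (hlogd z hz))
    (fun z hz => by linarith [neg_le_of_abs_le (hbound z hz)]) hy hx hxy
  have h2 := monotoneOn_of_hasDerivWithinAt_nonneg (convex_Icc (0 : ℝ) 1) (hmulc.sub hlogc)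
    (fun z hz => (hmuld z hz).sub (hlogd z hz))
    (fun z hz => by linarith [le_of_abs_le (hbound z hz)]) hy hx hxy
  simp only [Pi.add_apply, Pi.sub_apply] at h1 h2
  rw [abs_of_nonneg (sub_nonneg.2 (realMap_monotone hmono hxy)), abs_le]
  constructor <;> linarith

theorem IsC2Diffeo.dist_mul_fibreDeriv_le {g : unitInterval ≃ₜ unitInterval}
    (hg : IsC2Diffeo g) (hmono : Monotone g) {C : ℝ}
    (hC : ∀ x ∈ Set.Icc (0 : ℝ) 1, |fibreDeriv₂ g x| / (fibreDeriv g x) ^ 2 ≤ C)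
    (x a : unitInterval) :
    dist x a * fibreDeriv g a ≤ dist (g x) (g a) * Real.exp (C * dist (g x) (g a)) := by
  have hC0 : 0 ≤ C := (div_nonneg (abs_nonneg _) (sq_nonneg _)).trans (hC 0 (by simp))
  -- The distortion bound, along the segment between `a` and `x`, bounds the derivative below.
  have hderiv : ∀ ξ : ℝ, ξ ∈ Set.Icc (0 : ℝ) 1 →
      |realMap g ξ - realMap g a| ≤ dist (g x) (g a) →
      fibreDeriv g a ≤ fibreDeriv g ξ * Real.exp (C * dist (g x) (g a)) := by
    intro ξ hξ hle
    have h := (hg.abs_log_fibreDeriv_sub_le hmono hC hξ a.2).trans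
      (mul_le_mul_of_nonneg_left hle hC0)
    have hpos := hg.fibreDeriv_pos hmono hξ
    have hpos' := hg.fibreDeriv_pos hmono a.2
    rw [← Real.log_le_log_iff hpos' (by positivity), Real.log_mul hpos.ne' (Real.exp_ne_zero _),
      Real.log_exp]
    linarith [neg_le_of_abs_le h]
  have hmvt : ∀ u v : unitInterval, u < v → ∃ ξ ∈ Set.Ioo (u : ℝ) v,
      fibreDeriv g ξ * (v - u) = g v - g u := by
    intro u v huv
    have huv' : (u : ℝ) < v := huv
    have hsub : Set.Icc (u : ℝ) v ⊆ Set.Icc 0 1 := Set.Icc_subset_Icc u.2.1 v.2.2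
    obtain ⟨ξ, hξ, h⟩ := exists_hasDerivAt_eq_slope (realMap g) (fibreDeriv g) huv'
      (hg.differentiableOn.continuousOn.mono hsub) (fun z hz =>
        (hg.differentiableOn z (hsub (Set.Ioo_subset_Icc_self hz))).hasDerivWithinAt.hasDerivAt
          (Icc_mem_nhds (u.2.1.trans_lt hz.1) (hz.2.trans_le v.2.2)))
    refine ⟨ξ, hξ, ?_⟩
    rw [h, div_mul_cancel₀ _ (sub_pos.2 huv').ne', realMap_coe, realMap_coe]
  rw [Subtype.dist_eq x a, Real.dist_eq]
  have hdist : dist (g x) (g a) = |(g x : ℝ) - g a| := rfl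
  have hmr := realMap_monotone hmono
  rcases lt_trichotomy x a with hxa | rfl | hxa
  · obtain ⟨ξ, hξ, h⟩ := hmvt x a hxa
    have hax : (g x : ℝ) ≤ g a := hmono hxa.le
    have h1 := hmr hξ.1.le
    have h2 := hmr hξ.2.le
    rw [realMap_coe] at h1 h2
    have h3 := hderiv ξ ⟨x.2.1.trans hξ.1.le, hξ.2.le.trans a.2.2⟩ (by
      rw [hdist, realMap_coe, abs_of_nonpos (by linarith), abs_of_nonpos (by linarith)]
      linarith)
    have h4 : (x : ℝ) < a := hxa
    calc |(x : ℝ) - a| * fibreDeriv g a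
        ≤ (a - x) * (fibreDeriv g ξ * Real.exp (C * dist (g x) (g a))) := by
          rw [abs_of_neg (by linarith), neg_sub]
          exact mul_le_mul_of_nonneg_left h3 (by linarith)
      _ = (g a - g x) * Real.exp (C * dist (g x) (g a)) := by rw [← h]; ring
      _ = _ := by rw [hdist, abs_of_nonpos (by linarith : (g x : ℝ) - g a ≤ 0), neg_sub]
  · simp
  · obtain ⟨ξ, hξ, h⟩ := hmvt a x hxa
    have hax : (g a : ℝ) ≤ g x := hmono hxa.le
    have h1 := hmr hξ.1.le
    have h2 := hmr hξ.2.le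
    rw [realMap_coe] at h1 h2
    have h3 := hderiv ξ ⟨a.2.1.trans hξ.1.le, hξ.2.le.trans x.2.2⟩ (by
      rw [hdist, realMap_coe, abs_of_nonneg (by linarith), abs_of_nonneg (by linarith)]
      linarith)
    have h4 : (a : ℝ) < x := hxa
    calc |(x : ℝ) - a| * fibreDeriv g a
        ≤ (x - a) * (fibreDeriv g ξ * Real.exp (C * dist (g x) (g a))) := by
          rw [abs_of_pos (by linarith)]
          exact mul_le_mul_of_nonneg_left h3 (by linarith)
      _ = (g x - g a) * Real.exp (C * dist (g x) (g a)) := by rw [← h]; ring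
      _ = _ := by rw [hdist, abs_of_nonneg (by linarith : 0 ≤ (g x : ℝ) - g a)]

/-- The regularity hypothesis on the fibre maps enters only here: up to a factor `exp ε`, all of
them expand the distance to `a` by their derivative at `a`, on neighbourhoods whose images have a
common size. -/
theorem exists_uniform_expansion {Ω : Type*} {f : Ω → unitInterval ≃ₜ unitInterval}
    (hmono : ∀ ϑ, StrictMono (f ϑ)) {a : unitInterval}
    (hdiff : ∀ ϑ, FibreDifferentiableAt (f ϑ) a)
    (hfib : (Set.range f).Finite ∨ ((∀ ϑ, IsC2Diffeo (f ϑ)) ∧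
      ∃ C : ℝ, ∀ ϑ, ∀ x ∈ Set.Icc (0 : ℝ) 1,
        |fibreDeriv₂ (f ϑ) x| / (fibreDeriv (f ϑ) x) ^ 2 ≤ C)) {ε : ℝ} (hε : 0 < ε) :
    ∃ δ > 0, ∀ ϑ x, 0 < fibreDeriv (f ϑ) a → dist (f ϑ x) (f ϑ a) < δ →
      dist x a * fibreDeriv (f ϑ) a ≤ dist (f ϑ x) (f ϑ a) * Real.exp ε := by
  rcases hfib with hfin | ⟨hC2, C, hC⟩
  · have h : ∀ᶠ δ in 𝓝[>] (0 : ℝ), ∀ g ∈ Set.range f, 0 < fibreDeriv g a → ∀ x,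
        dist (g x) (g a) < δ → dist x a * fibreDeriv g a ≤ dist (g x) (g a) * Real.exp ε := by
      refine (eventually_all_finite hfin).2 ?_
      rintro _ ⟨ϑ, rfl⟩
      by_cases ha : 0 < fibreDeriv (f ϑ) a
      · filter_upwards [eventually_expanding (f ϑ) (hdiff ϑ) ha hε] with δ hδ _ using hδ
      · exact Eventually.of_forall fun δ h => absurd h ha
    obtain ⟨δ, hδ, hδ0⟩ := (h.and self_mem_nhdsWithin).exists
    exact ⟨δ, hδ0, fun ϑ x ha hx => hδ _ ⟨ϑ, rfl⟩ ha x hx⟩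
  · have hK : (0 : ℝ) < max C 1 := lt_max_of_lt_right one_pos
    refine ⟨ε / max C 1, div_pos hε hK, fun ϑ x _ hx => ?_⟩
    refine ((hC2 ϑ).dist_mul_fibreDeriv_le (hmono ϑ).monotone
      (C := max C 1) (fun y hy => (hC ϑ y hy).trans (le_max_left _ _)) x a).trans ?_
    rw [lt_div_iff₀ hK] at hx
    gcongr
    linarith

/-! ### Backward fibre dynamics -/

section Backward

variable {Ω : Type*} [MeasurableSpace Ω] (S : Ω ≃ᵐ Ω) (f : Ω → unitInterval ≃ₜ unitInterval)

/-- The fibre coordinate of the `n`-th backward iterate of `(ϑ, x)` under the skew product. -/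
def backward (n : ℕ) (ϑ : Ω) (x : unitInterval) : unitInterval :=
  ((skewProduct S f).symm^[n] (ϑ, x)).2

variable {S f}

theorem skewProduct_symm_apply (p : Ω × unitInterval) :
    (skewProduct S f).symm p = (S.symm p.1, (f (S.symm p.1)).symm p.2) := rfl

theorem skewProduct_apply (p : Ω × unitInterval) :
    skewProduct S f p = (S p.1, f p.1 p.2) := rfl

theorem fst_iterate_skewProduct (n : ℕ) (p : Ω × unitInterval) :
    ((skewProduct S f)^[n] p).1 = S^[n] p.1 := by
  induction n with
  | zero => rfl
  | succ n ih => rw [Function.iterate_succ_apply', Function.iterate_succ_apply', ← ih]; rfl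

theorem fst_iterate_skewProduct_symm (n : ℕ) (p : Ω × unitInterval) :
    ((skewProduct S f).symm^[n] p).1 = S.symm^[n] p.1 := by
  induction n with
  | zero => rfl
  | succ n ih => rw [Function.iterate_succ_apply', Function.iterate_succ_apply', ← ih]; rfl

theorem backward_succ (n : ℕ) (ϑ : Ω) (x : unitInterval) :
    backward S f (n + 1) ϑ x = (f (S.symm^[n + 1] ϑ)).symm (backward S f n ϑ x) := by
  simp only [backward]
  rw [Function.iterate_succ_apply', skewProduct_symm_apply, fst_iterate_skewProduct_symm,
    Function.iterate_succ_apply']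

theorem backward_succ_apply (n : ℕ) (ϑ : Ω) (x : unitInterval) :
    backward S f (n + 1) (S ϑ) (f ϑ x) = backward S f n ϑ x := by
  simp only [backward]
  rw [Function.iterate_succ_apply]
  simp [skewProduct_symm_apply]

theorem iterate_skewProduct_backward (n : ℕ) (ϑ : Ω) (x : unitInterval) :
    (skewProduct S f)^[n] (S.symm^[n] ϑ, backward S f n ϑ x) = (ϑ, x) := by
  have h : (S.symm^[n] ϑ, backward S f n ϑ x) = (skewProduct S f).symm^[n] (ϑ, x) :=
    Prod.ext (fst_iterate_skewProduct_symm n (ϑ, x)).symm rfl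
  rw [h]
  exact (skewProduct S f).right_inv.iterate n (ϑ, x)

theorem strictMono_snd_iterate_skewProduct (hmono : ∀ ϑ, StrictMono (f ϑ)) (n : ℕ) (ϑ : Ω) :
    StrictMono fun x => ((skewProduct S f)^[n] (ϑ, x)).2 := by
  induction n with
  | zero => exact fun x y h => h
  | succ n ih =>
    intro x y h
    simp only [Function.iterate_succ_apply', skewProduct_apply, fst_iterate_skewProduct]
    exact hmono _ (ih h)

theorem strictMono_backward (hmono : ∀ ϑ, StrictMono (f ϑ)) (n : ℕ) (ϑ : Ω) :
    StrictMono (backward S f n ϑ) := by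
  induction n with
  | zero => exact fun x y h => h
  | succ n ih =>
    intro x y h
    rw [backward_succ, backward_succ, ← (hmono (S.symm^[n + 1] ϑ)).lt_iff_lt,
      Homeomorph.apply_symm_apply, Homeomorph.apply_symm_apply]
    exact ih h

theorem measurable_skewProduct_symm (hmono : ∀ ϑ, StrictMono (f ϑ))
    (hmeas : ∀ x, Measurable fun ϑ => f ϑ x) : Measurable (skewProduct S f).symm := by
  have hinv : ∀ x, Measurable fun ϑ => (f ϑ).symm x := fun x => by
    refine measurable_of_Iic fun c => ?_
    have : (fun ϑ => (f ϑ).symm x) ⁻¹' Set.Iic c = {ϑ | x ≤ f ϑ c} := by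
      ext ϑ
      rw [Set.mem_preimage, Set.mem_Iic, Set.mem_ofPred_eq, ← (hmono ϑ).le_iff_le,
        Homeomorph.apply_symm_apply]
    rw [this]
    exact measurableSet_le measurable_const (hmeas c)
  have h : Measurable (Function.uncurry fun (x : unitInterval) ϑ => (f ϑ).symm x) :=
    measurable_uncurry_of_continuous_of_measurable (fun ϑ => (f ϑ).symm.continuous) hinv
  have hS : Measurable fun p : Ω × unitInterval => S.symm p.1 :=
    S.symm.measurable.comp measurable_fst
  exact hS.prodMk (h.comp (measurable_snd.prodMk hS))

theorem measurable_backward (hmono : ∀ ϑ, StrictMono (f ϑ))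
    (hmeas : ∀ x, Measurable fun ϑ => f ϑ x) (n : ℕ) (x : unitInterval) :
    Measurable fun ϑ => backward S f n ϑ x :=
  (((measurable_skewProduct_symm hmono hmeas).iterate n).comp
    (measurable_id.prodMk measurable_const)).snd

/-! ### Backward basins of the two levels -/

variable (S f)

/-- The points of the fibre over `ϑ` whose backward orbit tends to the level `a`. -/
def backwardBasin (a : unitInterval) (ϑ : Ω) : Set unitInterval :=
  {x | Tendsto (fun n => backward S f n ϑ x) atTop (𝓝 a)}

/-- The upper end of the backward basin of the level `0`. -/
def lowerBoundary (ϑ : Ω) : unitInterval := sSup (backwardBasin S f 0 ϑ)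

/-- The lower end of the backward basin of the level `1`. -/
def upperBoundary (ϑ : Ω) : unitInterval := sInf (backwardBasin S f 1 ϑ)

variable {S f}

theorem mem_backwardBasin_zero_of_lt (hmono : ∀ ϑ, StrictMono (f ϑ)) {ϑ : Ω} {x : unitInterval}
    (hx : x < lowerBoundary S f ϑ) : x ∈ backwardBasin S f 0 ϑ := by
  obtain ⟨y, hy, hxy⟩ := lt_sSup_iff.1 hx
  exact tendsto_of_tendsto_of_tendsto_of_le_of_le tendsto_const_nhds hy
    (fun n => unitInterval.nonneg') fun n => (strictMono_backward hmono n ϑ hxy).le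

theorem mem_backwardBasin_one_of_lt (hmono : ∀ ϑ, StrictMono (f ϑ)) {ϑ : Ω} {x : unitInterval}
    (hx : upperBoundary S f ϑ < x) : x ∈ backwardBasin S f 1 ϑ := by
  obtain ⟨y, hy, hxy⟩ := sInf_lt_iff.1 hx
  exact tendsto_of_tendsto_of_tendsto_of_le_of_le hy tendsto_const_nhds
    (fun n => (strictMono_backward hmono n ϑ hxy).le) fun n => unitInterval.le_one'

theorem lowerBoundary_le_upperBoundary (hmono : ∀ ϑ, StrictMono (f ϑ)) (ϑ : Ω) :
    lowerBoundary S f ϑ ≤ upperBoundary S f ϑ := by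
  by_contra! h
  obtain ⟨x, hx, hx'⟩ := exists_between h
  exact zero_ne_one (tendsto_nhds_unique (mem_backwardBasin_zero_of_lt hmono hx')
    (mem_backwardBasin_one_of_lt hmono hx))

theorem apply_mem_backwardBasin_iff {a : unitInterval} (ϑ : Ω) (x : unitInterval) :
    f ϑ x ∈ backwardBasin S f a (S ϑ) ↔ x ∈ backwardBasin S f a ϑ := by
  change Tendsto _ _ _ ↔ Tendsto _ _ _
  rw [← tendsto_add_atTop_iff_nat 1]
  simp_rw [backward_succ_apply]

theorem backwardBasin_apply (a : unitInterval) (ϑ : Ω) :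
    backwardBasin S f a (S ϑ) = f ϑ '' backwardBasin S f a ϑ := by
  ext y
  obtain ⟨x, rfl⟩ := (f ϑ).surjective y
  rw [apply_mem_backwardBasin_iff, (f ϑ).injective.mem_set_image]

theorem lowerBoundary_apply (hmono : ∀ ϑ, StrictMono (f ϑ)) (ϑ : Ω) :
    lowerBoundary S f (S ϑ) = f ϑ (lowerBoundary S f ϑ) := by
  rw [lowerBoundary, lowerBoundary, backwardBasin_apply, sSup_image]
  exact (((hmono ϑ).orderIsoOfSurjective _ (f ϑ).surjective).map_sSup _).symm

theorem upperBoundary_apply (hmono : ∀ ϑ, StrictMono (f ϑ)) (ϑ : Ω) :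
    upperBoundary S f (S ϑ) = f ϑ (upperBoundary S f ϑ) := by
  rw [upperBoundary, upperBoundary, backwardBasin_apply, sInf_image]
  exact (((hmono ϑ).orderIsoOfSurjective _ (f ϑ).surjective).map_sInf _).symm

theorem measurableSet_mem_backwardBasin (hmono : ∀ ϑ, StrictMono (f ϑ))
    (hmeas : ∀ x, Measurable fun ϑ => f ϑ x) (a x : unitInterval) :
    MeasurableSet {ϑ | x ∈ backwardBasin S f a ϑ} :=
  measurableSet_tendsto (𝓝 a) fun n => measurable_backward hmono hmeas n x

theorem measurable_lowerBoundary (hmono : ∀ ϑ, StrictMono (f ϑ))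
    (hmeas : ∀ x, Measurable fun ϑ => f ϑ x) : Measurable (lowerBoundary S f) := by
  obtain ⟨D, hDc, hD⟩ := TopologicalSpace.exists_countable_dense unitInterval
  refine measurable_of_Ioi fun c => ?_
  have : lowerBoundary S f ⁻¹' Set.Ioi c
      = ⋃ q ∈ {q ∈ D | c < q}, {ϑ | q ∈ backwardBasin S f 0 ϑ} := by
    ext ϑ
    simp only [Set.mem_preimage, Set.mem_Ioi, Set.mem_iUnion, Set.mem_ofPred_eq, exists_prop]
    constructor
    · intro h
      obtain ⟨q, hq, hcq, hq'⟩ := hD.exists_between h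
      exact ⟨q, ⟨hq, hcq⟩, mem_backwardBasin_zero_of_lt hmono hq'⟩
    · rintro ⟨q, ⟨_, hcq⟩, hq⟩
      exact hcq.trans_le (le_sSup hq)
  rw [this]
  exact MeasurableSet.biUnion (hDc.mono fun q hq => hq.1)
    fun q _ => measurableSet_mem_backwardBasin hmono hmeas 0 q

theorem measurable_upperBoundary (hmono : ∀ ϑ, StrictMono (f ϑ))
    (hmeas : ∀ x, Measurable fun ϑ => f ϑ x) : Measurable (upperBoundary S f) := by
  obtain ⟨D, hDc, hD⟩ := TopologicalSpace.exists_countable_dense unitInterval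
  refine measurable_of_Iio fun c => ?_
  have : upperBoundary S f ⁻¹' Set.Iio c
      = ⋃ q ∈ {q ∈ D | q < c}, {ϑ | q ∈ backwardBasin S f 1 ϑ} := by
    ext ϑ
    simp only [Set.mem_preimage, Set.mem_Iio, Set.mem_iUnion, Set.mem_ofPred_eq, exists_prop]
    constructor
    · intro h
      obtain ⟨q, hq, hcq, hq'⟩ := hD.exists_between h
      exact ⟨q, ⟨hq, hq'⟩, mem_backwardBasin_one_of_lt hmono hcq⟩
    · rintro ⟨q, ⟨_, hcq⟩, hq⟩
      exact (sInf_le hq).trans_lt hcq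
  rw [this]
  exact MeasurableSet.biUnion (hDc.mono fun q hq => hq.1)
    fun q _ => measurableSet_mem_backwardBasin hmono hmeas 1 q

theorem iterate_skewProduct_section {ψ : Ω → unitInterval} {ϑ : Ω}
    (hψ : ∀ n : ℕ, ψ (S (S^[n] ϑ)) = f (S^[n] ϑ) (ψ (S^[n] ϑ))) (n : ℕ) :
    (skewProduct S f)^[n] (ϑ, ψ ϑ) = (S^[n] ϑ, ψ (S^[n] ϑ)) := by
  induction n with
  | zero => rfl
  | succ n ih =>
    rw [Function.iterate_succ_apply', ih, skewProduct_apply, Function.iterate_succ_apply',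
      hψ n]

/-! ### Backward attraction by the two levels -/

/-- A sequence that near `0` contracts by factors `exp (-c n)` with `∑ c n = ∞` tends to `0`,
provided that it starts so close to `0` that it never leaves the region of contraction. -/
theorem exists_pos_tendsto_zero_of_contracting {c : ℕ → ℝ}
    (hc : Tendsto (fun n => ∑ k ∈ Finset.range n, c k) atTop atTop) {δ : ℝ} (hδ : 0 < δ) :
    ∃ η > 0, ∀ u : ℕ → ℝ, (∀ n, 0 ≤ u n) → u 0 < η →
      (∀ n, u n < δ → u (n + 1) ≤ u n * Real.exp (-c n)) → Tendsto u atTop (𝓝 0) := by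
  obtain ⟨K, hK⟩ := bddBelow_range_of_tendsto_atTop_atTop hc
  refine ⟨δ * Real.exp K, by positivity, fun u hu0 hu hstep => ?_⟩
  have hsmall : ∀ n, u 0 * Real.exp (-∑ k ∈ Finset.range n, c k) < δ := fun n => by
    have h : Real.exp (-∑ k ∈ Finset.range n, c k) ≤ Real.exp (-K) :=
      Real.exp_le_exp.2 (neg_le_neg (hK ⟨n, rfl⟩))
    calc u 0 * Real.exp (-∑ k ∈ Finset.range n, c k) ≤ u 0 * Real.exp (-K) :=
          mul_le_mul_of_nonneg_left h (hu0 0)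
      _ < δ * Real.exp K * Real.exp (-K) := by gcongr
      _ = δ := by rw [mul_assoc, ← Real.exp_add, add_neg_cancel, Real.exp_zero, mul_one]
  have hle : ∀ n, u n ≤ u 0 * Real.exp (-∑ k ∈ Finset.range n, c k) := fun n => by
    induction n with
    | zero => simp
    | succ n ih =>
      refine (hstep n (ih.trans_lt (hsmall n))).trans ?_
      rw [Finset.sum_range_succ, neg_add, Real.exp_add, ← mul_assoc]
      gcongr
  refine squeeze_zero hu0 hle ?_
  have := (Real.tendsto_exp_neg_atTop_nhds_zero.comp hc).const_mul (u 0)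
  simpa using this

variable {μ : Measure Ω} [IsProbabilityMeasure μ]

/-- A level that is fixed by all fibre maps and has positive Lyapunov exponent attracts, in
backward time, a neighbourhood of itself in almost every fibre. -/
theorem ae_exists_ball_subset_backwardBasin (hS : Ergodic S μ) (hmono : ∀ ϑ, StrictMono (f ϑ))
    (hmeas : ∀ x, Measurable fun ϑ => f ϑ x) {a : unitInterval} (ha : ∀ ϑ, f ϑ a = a)
    (hdiff : ∀ ϑ, FibreDifferentiableAt (f ϑ) a) (hΛ : 0 < exponent μ f a)
    (hfib : (Set.range f).Finite ∨ ((∀ ϑ, IsC2Diffeo (f ϑ)) ∧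
      ∃ C : ℝ, ∀ ϑ, ∀ x ∈ Set.Icc (0 : ℝ) 1,
        |fibreDeriv₂ (f ϑ) x| / (fibreDeriv (f ϑ) x) ^ 2 ≤ C)) :
    ∀ᵐ ϑ ∂μ, ∃ η > 0, Metric.ball a η ⊆ backwardBasin S f a ϑ := by
  have hLm : Measurable (logDeriv f a) :=
    ENNReal.measurable_log.comp (measurable_fibreDeriv hmeas hdiff).ennreal_ofReal
  obtain ⟨b, hbm, hbi, hble, hbpos⟩ := exists_integrable_le_of_pos hLm hΛ
  -- Half of the integral is given away to absorb the distortion factor `exp ε`.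
  set ε := (∫ ϑ, b ϑ ∂μ) / 2 with hε
  have hε0 : 0 < ε := half_pos hbpos
  obtain ⟨δ, hδ, hexp⟩ := exists_uniform_expansion hmono hdiff hfib hε0
  have hSs : Ergodic S.symm μ := hS.symm
  -- The `n`-th backward step applies the inverse of the fibre map over `S⁻ⁿ⁻¹ ϑ`, hence the shift
  -- of `b` by `S⁻¹`.
  have hgi : Integrable (fun ϑ => b (S.symm ϑ) - ε) μ :=
    (hSs.toMeasurePreserving.integrable_comp_of_integrable hbi).sub (integrable_const ε)
  have hgpos : 0 < ∫ ϑ, (b (S.symm ϑ) - ε) ∂μ := by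
    have hbi' : Integrable (fun ϑ => b (S.symm ϑ)) μ :=
      hSs.toMeasurePreserving.integrable_comp_of_integrable hbi
    rw [integral_sub hbi' (integrable_const ε), hSs.toMeasurePreserving.integral_comp' b]
    simp only [integral_const, probReal_univ, smul_eq_mul, one_mul]
    linarith
  have hsum := ae_tendsto_birkhoffSum_atTop hSs ((hbm.comp S.symm.measurable).sub_const ε)
    hgi hgpos
  have hble' : ∀ᵐ ϑ ∂μ, ∀ n : ℕ, (b (S.symm^[n] ϑ) : EReal) ≤ logDeriv f a (S.symm^[n] ϑ) :=
    ae_all_iff.2 fun n =>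
      (hSs.toMeasurePreserving.iterate n).quasiMeasurePreserving.ae hble
  filter_upwards [hsum, hble'] with ϑ hϑ hb
  obtain ⟨η, hη, hcontr⟩ := exists_pos_tendsto_zero_of_contracting hϑ hδ
  refine ⟨η, hη, fun x hx => tendsto_iff_dist_tendsto_zero.2 ?_⟩
  refine hcontr _ (fun n => dist_nonneg) hx fun n hn => ?_
  set ω := S.symm^[n + 1] ϑ with hω
  have hωs : S.symm (S.symm^[n] ϑ) = ω := (Function.iterate_succ_apply' _ _ _).symm
  have hbω := hb (n + 1)
  rw [← hω, logDeriv] at hbω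
  have hdpos : 0 < fibreDeriv (f ω) a := by
    by_contra! h
    rw [ENNReal.ofReal_of_nonpos h, ENNReal.log_zero] at hbω
    exact EReal.coe_ne_bot _ (le_bot_iff.1 hbω)
  rw [ENNReal.log_ofReal_of_pos hdpos, EReal.coe_le_coe_iff, Real.le_log_iff_exp_le hdpos]
    at hbω
  have hstep := hexp ω (backward S f (n + 1) ϑ x) hdpos
  rw [backward_succ, ← hω, Homeomorph.apply_symm_apply, ha] at hstep
  have hstep' := hstep hn
  rw [backward_succ, ← hω]
  change _ ≤ _ * Real.exp (-(b (S.symm (S.symm^[n] ϑ)) - ε))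
  rw [hωs, neg_sub, Real.exp_sub, mul_div_assoc', le_div_iff₀ (Real.exp_pos _)]
  exact (mul_le_mul_of_nonneg_left hbω dist_nonneg).trans hstep'

end Backward

/-! ### Recurrence and empirical measures -/

/-- A bounded function that tends to `0` along almost every orbit of a measure preserving map
vanishes almost everywhere. -/
theorem ae_eq_zero_of_tendsto_iterate {α : Type*} [MeasurableSpace α] {μ : Measure α}
    [IsFiniteMeasure μ] {T : α → α} (hT : MeasurePreserving T μ μ) {g : α → ℝ} {K : ℝ}
    (hm : Measurable g) (h0 : ∀ x, 0 ≤ g x) (hK : ∀ x, g x ≤ K)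
    (hlim : ∀ᵐ x ∂μ, Tendsto (fun n : ℕ => g (T^[n] x)) atTop (𝓝 0)) : ∀ᵐ x ∂μ, g x = 0 := by
  have hnorm : ∀ x, ‖g x‖ ≤ K := fun x => by rw [Real.norm_of_nonneg (h0 x)]; exact hK x
  have hi : Integrable g μ :=
    (integrable_const K).mono' hm.aestronglyMeasurable (ae_of_all _ hnorm)
  have hint : ∀ n : ℕ, ∫ x, g (T^[n] x) ∂μ = ∫ x, g x ∂μ := fun n => by
    conv_rhs => rw [← (hT.iterate n).map_eq]
    rw [integral_map (hT.iterate n).measurable.aemeasurable hm.aestronglyMeasurable]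
  have h := tendsto_integral_of_dominated_convergence (μ := μ) (fun _ => K)
    (F := fun (n : ℕ) x => g (T^[n] x))
    (fun n => (hm.comp (hT.iterate n).measurable).aestronglyMeasurable) (integrable_const K)
    (fun n => ae_of_all _ fun x => hnorm _) hlim
  simp_rw [hint, integral_zero] at h
  exact (integral_eq_zero_iff_of_nonneg h0 hi).1 (tendsto_const_nhds_iff.1 h)

theorem integral_empiricalMeasure {X : Type*} [TopologicalSpace X] [MeasurableSpace X]
    [BorelSpace X] {F : X → X} (hF : Measurable F) (p : X) (n : ℕ) (h : C(X, ℝ)) :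
    ∫ q, h q ∂(empiricalMeasure F p n) = birkhoffSum F h n p / n := by
  have hsm : StronglyMeasurable h := h.continuous.measurable.stronglyMeasurable
  have hi : ∀ q : X, Integrable h (Measure.dirac q) := fun q =>
    (integrable_dirac' hsm (by simp))
  rw [empiricalMeasure, integral_smul_measure]
  simp_rw [Measure.map_dirac' (hF.iterate _)]
  rw [integral_finsetSum_measure fun k _ => hi _]
  simp_rw [integral_dirac' _ _ hsm]
  rw [ENNReal.toReal_inv, ENNReal.toReal_natCast, smul_eq_mul, div_eq_inv_mul]
  rfl

/-- Orbits that are asymptotic to each other have the same limits of Birkhoff averages of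
continuous functions. -/
theorem tendsto_birkhoffSum_div_of_dist {X : Type*} [PseudoMetricSpace X] [CompactSpace X]
    {F : X → X} {p q : X}
    (hpq : Tendsto (fun n : ℕ => dist (F^[n] p) (F^[n] q)) atTop (𝓝 0)) (h : C(X, ℝ)) {L : ℝ}
    (hq : Tendsto (fun n : ℕ => birkhoffSum F h n q / n) atTop (𝓝 L)) :
    Tendsto (fun n : ℕ => birkhoffSum F h n p / n) atTop (𝓝 L) := by
  have huc := CompactSpace.uniformContinuous_of_continuous h.continuous
  have hdiff : Tendsto (fun n : ℕ => h (F^[n] p) - h (F^[n] q)) atTop (𝓝 0) := by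
    rw [tendsto_zero_iff_norm_tendsto_zero]
    simp_rw [← dist_eq_norm]
    rw [Metric.tendsto_atTop] at hpq ⊢
    intro ε hε
    obtain ⟨δ, hδ, H⟩ := Metric.uniformContinuous_iff.1 huc ε hε
    obtain ⟨N, hN⟩ := hpq δ hδ
    refine ⟨N, fun n hn => ?_⟩
    have := H (a := F^[n] p) (b := F^[n] q) (by simpa using hN n hn)
    simpa using this
  have := hdiff.cesaro.add hq
  rw [zero_add] at this
  refine this.congr fun n => ?_
  simp only [birkhoffSum, Finset.sum_sub_distrib]
  ring

/-- If the Birkhoff averages along the orbit of `p` converge to the integrals for a dense set of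
continuous functions, then they do so for all continuous functions. -/
theorem tendsto_birkhoffSum_div_of_dense {X : Type*} [TopologicalSpace X] [CompactSpace X]
    [MeasurableSpace X] [BorelSpace X] {F : X → X} {p : X} {ν : Measure X}
    [IsProbabilityMeasure ν] {D : Set C(X, ℝ)} (hD : Dense D)
    (hlim : ∀ h ∈ D, Tendsto (fun n : ℕ => birkhoffSum F h n p / n) atTop (𝓝 (∫ q, h q ∂ν)))
    (h : C(X, ℝ)) :
    Tendsto (fun n : ℕ => birkhoffSum F h n p / n) atTop (𝓝 (∫ q, h q ∂ν)) := by
  have hi : ∀ g : C(X, ℝ), Integrable g ν := fun g =>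
    (integrable_const ‖g‖).mono' g.continuous.measurable.aestronglyMeasurable
      (ae_of_all _ fun x => g.norm_coe_le_norm x)
  rw [Metric.tendsto_atTop]
  intro ε hε
  obtain ⟨g, hgD, hg⟩ := hD.exists_dist_lt h (by positivity : 0 < ε / 3)
  obtain ⟨N, hN⟩ := Metric.tendsto_atTop.1 (hlim g hgD) (ε / 3) (by positivity)
  refine ⟨N, fun n hn => ?_⟩
  have hpt : ∀ x, |h x - g x| ≤ ε / 3 := fun x => by
    rw [← Real.dist_eq]
    exact (ContinuousMap.dist_apply_le_dist x).trans hg.le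
  have h1 : |birkhoffSum F h n p / n - birkhoffSum F g n p / n| ≤ ε / 3 := by
    rcases n.eq_zero_or_pos with rfl | hn0
    · simpa using by positivity
    have hn0' : (0 : ℝ) < n := by exact_mod_cast hn0
    rw [← sub_div, abs_div, abs_of_pos hn0', div_le_iff₀ hn0', birkhoffSum, birkhoffSum,
      ← Finset.sum_sub_distrib]
    refine (Finset.abs_sum_le_sum_abs _ _).trans
      ((Finset.sum_le_sum fun k _ => hpt (F^[k] p)).trans ?_)
    simp [mul_comm]
  have h2 : |∫ q, g q ∂ν - ∫ q, h q ∂ν| ≤ ε / 3 := by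
    rw [← integral_sub (hi g) (hi h), ← Real.norm_eq_abs]
    refine (norm_integral_le_of_norm_le_const (C := ε / 3) (ae_of_all _ fun x => ?_)).trans ?_
    · rw [Real.norm_eq_abs, abs_sub_comm]
      exact hpt x
    · simp
  have h3 := hN n hn
  rw [Real.dist_eq] at h3 ⊢
  rw [abs_le] at h1 h2
  rw [abs_lt] at h3 ⊢
  constructor <;> linarith

theorem ae_weakStarTendsto_empiricalMeasure {Ω : Type*} [MeasurableSpace Ω] {μ : Measure Ω}
    [IsProbabilityMeasure μ] {S : Ω ≃ᵐ Ω} (hS : Ergodic S μ)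
    {f : Ω → unitInterval ≃ₜ unitInterval} {φ : Ω → unitInterval} (hφ : Measurable φ)
    (hinv : ∀ᵐ ϑ ∂μ, ∀ n : ℕ, (skewProduct S f)^[n] (ϑ, φ ϑ) = (S^[n] ϑ, φ (S^[n] ϑ)))
    (hattr : ∀ᵐ ϑ ∂μ, ∀ x ∈ Set.Ioo (0 : unitInterval) 1,
      Tendsto (fun n : ℕ => |(((skewProduct S f)^[n] (ϑ, x)).2 : ℝ) - (φ (S^[n] ϑ) : ℝ)|)
        atTop (𝓝 0))
    [MetricSpace Ω] [CompactSpace Ω] [BorelSpace Ω] (hF : Continuous (skewProduct S f)) :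
    ∀ᵐ ϑ ∂μ, ∀ x ∈ Set.Ioo (0 : unitInterval) 1,
      WeakStarTendsto (empiricalMeasure (skewProduct S f) (ϑ, x)) (graphMeasure μ φ) := by
  have hgraph : Measurable fun ϑ => (ϑ, φ ϑ) := measurable_id.prodMk hφ
  have : IsProbabilityMeasure (graphMeasure μ φ) :=
    Measure.isProbabilityMeasure_map hgraph.aemeasurable
  obtain ⟨D, hDc, hD⟩ := TopologicalSpace.exists_countable_dense C(Ω × unitInterval, ℝ)
  have hbirk : ∀ᵐ ϑ ∂μ, ∀ h ∈ D,
      Tendsto (fun n : ℕ => birkhoffSum S (fun ω => h (ω, φ ω)) n ϑ / n) atTop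
        (𝓝 (∫ q, h q ∂(graphMeasure μ φ))) := by
    refine (ae_ball_iff hDc).2 fun h _ => ?_
    have hm : Measurable fun ω => h (ω, φ ω) := h.continuous.measurable.comp hgraph
    have hi : Integrable (fun ω => h (ω, φ ω)) μ :=
      (integrable_const ‖h‖).mono' hm.aestronglyMeasurable
        (ae_of_all _ fun x => h.norm_coe_le_norm _)
    rw [graphMeasure, integral_map hgraph.aemeasurable
      h.continuous.measurable.aestronglyMeasurable]
    exact ae_tendsto_birkhoffSum_div hS hm hi
  filter_upwards [hbirk, hinv, hattr] with ϑ h1 h2 h3 x hx h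
  simp_rw [integral_empiricalMeasure hF.measurable]
  refine tendsto_birkhoffSum_div_of_dist (q := (ϑ, φ ϑ)) ?_ h
    (tendsto_birkhoffSum_div_of_dense hD (fun g hg => ?_) h)
  · refine (h3 x hx).congr fun n => ?_
    rw [h2 n, Prod.dist_eq, fst_iterate_skewProduct, dist_self, max_eq_right dist_nonneg]
    rfl
  · refine (h1 g hg).congr fun n => ?_
    simp only [birkhoffSum, h2]

/-! ### The invariant graph -/

theorem exists_gt_of_eventually_nhds {a b : unitInterval} (hab : a < b) {P : unitInterval → Prop}
    (hP : ∀ᶠ x in 𝓝 a, P x) : ∃ x > a, P x := by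
  have : (𝓝[>] a).NeBot := nhdsGT_neBot_of_exists_gt ⟨b, hab⟩
  obtain ⟨x, hx, hax⟩ :=
    ((eventually_nhdsWithin_of_eventually_nhds hP).and (self_mem_nhdsWithin (s := Set.Ioi a))).exists
  exact ⟨x, hax, hx⟩

theorem exists_lt_of_eventually_nhds {a b : unitInterval} (hba : b < a) {P : unitInterval → Prop}
    (hP : ∀ᶠ x in 𝓝 a, P x) : ∃ x < a, P x := by
  have : (𝓝[<] a).NeBot := nhdsLT_neBot_of_exists_lt ⟨b, hba⟩
  obtain ⟨x, hx, hxa⟩ :=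
    ((eventually_nhdsWithin_of_eventually_nhds hP).and (self_mem_nhdsWithin (s := Set.Iio a))).exists
  exact ⟨x, hxa, hx⟩

end IntervalSkew

end

open IntervalSkew in
theorem theorem3p2 {Ω : Type*} [MeasurableSpace Ω] (μ : Measure Ω) [IsProbabilityMeasure μ]
    (S : Ω ≃ᵐ Ω) (hS : Ergodic S μ)
    (f : Ω → unitInterval ≃ₜ unitInterval)
    -- orientation preserving, and depending measurably on the base point
    (hmono : ∀ ϑ, StrictMono (f ϑ))
    (hmeas : ∀ x, Measurable (fun ϑ => f ϑ x))
    (hdiff₀ : ∀ ϑ, IntervalSkew.FibreDifferentiableAt (f ϑ) 0)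
    (hdiff₁ : ∀ ϑ, IntervalSkew.FibreDifferentiableAt (f ϑ) 1)
    (hΛ₀ : 0 < IntervalSkew.exponent μ f 0)
    (hΛ₁ : 0 < IntervalSkew.exponent μ f 1)
    (hfib : (Set.range f).Finite ∨
      ((∀ ϑ, IntervalSkew.IsC2Diffeo (f ϑ)) ∧
        ∃ C : ℝ, ∀ ϑ, ∀ x ∈ Set.Icc (0 : ℝ) 1,
          |IntervalSkew.fibreDeriv₂ (f ϑ) x| / (IntervalSkew.fibreDeriv (f ϑ) x) ^ 2 ≤ C))
    (hcontr : IntervalSkew.EssentiallyContracting μ (IntervalSkew.skewProduct S f)) :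
    ∃ φ : Ω → unitInterval, Measurable φ ∧ (∀ ϑ, φ ϑ ∈ Set.Ioo (0 : unitInterval) 1) ∧
      -- (a) the graph separates the basins of the two levels in backward time
      (∀ᵐ ϑ ∂μ, ∀ x : unitInterval,
        (x < φ ϑ → Tendsto (fun n : ℕ => ((IntervalSkew.skewProduct S f).symm^[n] (ϑ, x)).2)
          atTop (𝓝 0)) ∧
        (φ ϑ < x → Tendsto (fun n : ℕ => ((IntervalSkew.skewProduct S f).symm^[n] (ϑ, x)).2)
          atTop (𝓝 1))) ∧
      -- (b) the graph is invariant
      IntervalSkew.GraphInvariant μ S f φ ∧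
      -- (c) the graph is a forward attractor
      (∀ᵐ ϑ ∂μ, ∀ x ∈ Set.Ioo (0 : unitInterval) 1,
        Tendsto (fun n : ℕ =>
          |(((IntervalSkew.skewProduct S f)^[n] (ϑ, x)).2 : ℝ) - (φ (S^[n] ϑ) : ℝ)|)
          atTop (𝓝 0)) ∧
      -- (d) the graph is a pullback attractor
      (∀ᵐ ϑ ∂μ, ∀ A : Set unitInterval, IsCompact A → A ⊆ Set.Ioo 0 1 →
        ∀ ε : ℝ, 0 < ε → ∃ N : ℕ, ∀ n : ℕ, N ≤ n →
          ∀ y ∈ Prod.snd '' ((IntervalSkew.skewProduct S f)^[n] '' ({S.symm^[n] ϑ} ×ˢ A)),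
            (y : ℝ) ∈ Set.Ioo ((φ ϑ : ℝ) - ε) ((φ ϑ : ℝ) + ε)) ∧
      -- (e) convergence of the empirical measures in the topological case
      (∀ [MetricSpace Ω] [CompactSpace Ω] [BorelSpace Ω],
        Continuous (IntervalSkew.skewProduct S f) →
        ∀ᵐ ϑ ∂μ, ∀ x ∈ Set.Ioo (0 : unitInterval) 1,
          IntervalSkew.WeakStarTendsto
            (IntervalSkew.empiricalMeasure (IntervalSkew.skewProduct S f) (ϑ, x))
            (IntervalSkew.graphMeasure μ φ)) := by
  classical
  have hf0 : ∀ ϑ, f ϑ 0 = 0 := fun ϑ =>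
    ((hmono ϑ).orderIsoOfSurjective _ (f ϑ).surjective).map_bot
  have hf1 : ∀ ϑ, f ϑ 1 = 1 := fun ϑ =>
    ((hmono ϑ).orderIsoOfSurjective _ (f ϑ).surjective).map_top
  have hlm := measurable_lowerBoundary (S := S) hmono hmeas
  have hum := measurable_upperBoundary (S := S) hmono hmeas
  have hlu := lowerBoundary_le_upperBoundary (S := S) hmono
  have hpos : ∀ᵐ ϑ ∂μ, 0 < lowerBoundary S f ϑ := by
    filter_upwards [ae_exists_ball_subset_backwardBasin hS hmono hmeas (a := 0) hf0 hdiff₀ hΛ₀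
      hfib] with ϑ ⟨η, hη, hball⟩
    obtain ⟨x, hx0, hx⟩ := exists_gt_of_eventually_nhds zero_lt_one
      (Metric.ball_mem_nhds (0 : unitInterval) hη)
    exact lt_of_lt_of_le hx0 (le_sSup (hball hx))
  have hlt : ∀ᵐ ϑ ∂μ, upperBoundary S f ϑ < 1 := by
    filter_upwards [ae_exists_ball_subset_backwardBasin hS hmono hmeas (a := 1) hf1 hdiff₁ hΛ₁
      hfib] with ϑ ⟨η, hη, hball⟩
    obtain ⟨x, hx1, hx⟩ := exists_lt_of_eventually_nhds zero_lt_one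
      (Metric.ball_mem_nhds (1 : unitInterval) hη)
    exact lt_of_le_of_lt (sInf_le (hball hx)) hx1
  -- The two boundaries are invariant sections, so contraction makes their distance recur to `0`.
  have heq : ∀ᵐ ϑ ∂μ, (upperBoundary S f ϑ : ℝ) - lowerBoundary S f ϑ = 0 := by
    refine ae_eq_zero_of_tendsto_iterate hS.toMeasurePreserving (K := 1)
      (hum.subtype_val.sub hlm.subtype_val) (fun ϑ => sub_nonneg.2 (hlu ϑ))
      (fun ϑ => ?_) ?_
    · linarith [(upperBoundary S f ϑ).2.2, (lowerBoundary S f ϑ).2.1]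
    · filter_upwards [hpos, hlt, hcontr] with ϑ h0 h1 hc
      refine (hc _ ⟨h0.trans_le (hlu ϑ), h1⟩ _ ⟨h0, (hlu ϑ).trans_lt h1⟩).congr fun n => ?_
      rw [iterate_skewProduct_section (ψ := upperBoundary S f)
          (fun n => upperBoundary_apply hmono _),
        iterate_skewProduct_section (ψ := lowerBoundary S f)
          (fun n => lowerBoundary_apply hmono _)]
      exact abs_of_nonneg (sub_nonneg.2 (hlu _))
  set E : Set Ω := {ϑ | 0 < lowerBoundary S f ϑ ∧ upperBoundary S f ϑ < 1 ∧
    lowerBoundary S f ϑ = upperBoundary S f ϑ} with hE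
  have hEm : MeasurableSet E :=
    (measurableSet_lt measurable_const hlm).inter
      ((measurableSet_lt hum measurable_const).inter (measurableSet_eq_fun hlm hum))
  have hEae : ∀ᵐ ϑ ∂μ, ϑ ∈ E := by
    filter_upwards [hpos, hlt, heq] with ϑ h0 h1 h2
    exact ⟨h0, h1, Subtype.ext (sub_eq_zero.1 h2).symm⟩
  have hES : ∀ ϑ, S ϑ ∈ E ↔ ϑ ∈ E := fun ϑ => by
    have h0 := (hmono ϑ).lt_iff_lt (a := 0) (b := lowerBoundary S f ϑ)
    have h1 := (hmono ϑ).lt_iff_lt (a := upperBoundary S f ϑ) (b := 1)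
    rw [hf0] at h0
    rw [hf1] at h1
    change (_ ∧ _ ∧ _) ↔ (_ ∧ _ ∧ _)
    rw [lowerBoundary_apply hmono, upperBoundary_apply hmono, h0, h1, (f ϑ).injective.eq_iff]
  have hEn : ∀ ϑ ∈ E, ∀ n : ℕ, S^[n] ϑ ∈ E := fun ϑ hϑ n => by
    induction n with
    | zero => exact hϑ
    | succ n ih => rw [Function.iterate_succ_apply']; exact (hES _).2 ih
  obtain ⟨c, hc0, hc1⟩ := exists_between (zero_lt_one : (0 : unitInterval) < 1)
  -- Off the null set `Eᶜ` the value of the section does not matter.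
  set φ : Ω → unitInterval := E.piecewise (lowerBoundary S f) fun _ => c with hφ
  have hφE : ∀ ϑ ∈ E, φ ϑ = lowerBoundary S f ϑ := fun ϑ hϑ => Set.piecewise_eq_of_mem _ _ _ hϑ
  have hφm : Measurable φ := hlm.piecewise hEm measurable_const
  have hφI : ∀ ϑ, φ ϑ ∈ Set.Ioo (0 : unitInterval) 1 := fun ϑ => by
    by_cases hϑ : ϑ ∈ E
    · rw [hφE ϑ hϑ]
      exact ⟨hϑ.1, hϑ.2.2.trans_lt hϑ.2.1⟩
    · rw [hφ, Set.piecewise_eq_of_notMem _ _ _ hϑ]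
      exact ⟨hc0, hc1⟩
  have hφS : ∀ ϑ ∈ E, φ (S ϑ) = f ϑ (φ ϑ) := fun ϑ hϑ => by
    rw [hφE ϑ hϑ, hφE _ ((hES ϑ).2 hϑ), lowerBoundary_apply hmono]
  have hφn : ∀ ϑ ∈ E, ∀ n : ℕ, (skewProduct S f)^[n] (ϑ, φ ϑ) = (S^[n] ϑ, φ (S^[n] ϑ)) :=
    fun ϑ hϑ => iterate_skewProduct_section fun n => hφS _ (hEn ϑ hϑ n)
  have hlow : ∀ ϑ ∈ E, ∀ x, x < φ ϑ → x ∈ backwardBasin S f 0 ϑ := fun ϑ hϑ x hx =>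
    mem_backwardBasin_zero_of_lt hmono (by rwa [hφE ϑ hϑ] at hx)
  have hupp : ∀ ϑ ∈ E, ∀ x, φ ϑ < x → x ∈ backwardBasin S f 1 ϑ := fun ϑ hϑ x hx =>
    mem_backwardBasin_one_of_lt hmono (by rwa [hφE ϑ hϑ, hϑ.2.2] at hx)
  have hattr : ∀ᵐ ϑ ∂μ, ∀ x ∈ Set.Ioo (0 : unitInterval) 1, Tendsto (fun n : ℕ =>
      |(((skewProduct S f)^[n] (ϑ, x)).2 : ℝ) - (φ (S^[n] ϑ) : ℝ)|) atTop (𝓝 0) := by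
    filter_upwards [hEae, hcontr] with ϑ hϑ hc x hx
    refine (hc x hx (φ ϑ) (hφI ϑ)).congr fun n => ?_
    rw [hφn ϑ hϑ n]
  refine ⟨φ, hφm, hφI, ?_, ⟨E, hEm, mem_ae_iff.1 hEae, ?_, ?_⟩, hattr, ?_, ?_⟩
  · filter_upwards [hEae] with ϑ hϑ x
    exact ⟨hlow ϑ hϑ x, hupp ϑ hϑ x⟩
  · ext ϑ
    constructor
    · rintro ⟨ω, hω, rfl⟩
      exact (hES ω).2 hω
    · intro hϑ
      exact ⟨S.symm ϑ, (hES _).1 (by simpa using hϑ), by simp⟩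
  · ext p
    constructor
    · rintro ⟨_, ⟨ω, hω, rfl⟩, rfl⟩
      exact ⟨S ω, (hES ω).2 hω, Prod.ext rfl (hφS ω hω)⟩
    · rintro ⟨ϑ, hϑ, rfl⟩
      have hω : S.symm ϑ ∈ E := (hES _).1 (by simpa using hϑ)
      refine ⟨_, ⟨S.symm ϑ, hω, rfl⟩, ?_⟩
      rw [skewProduct_apply, ← hφS _ hω, S.apply_symm_apply]
  · -- A point between `φ ϑ` and `φ ϑ ± ε` is pulled back beyond the compact set `A`, so that
    -- forward iteration over the same fibres keeps the image of `A` on this side of it.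
    filter_upwards [hEae] with ϑ hϑ A hA hAI ε hε
    rcases A.eq_empty_or_nonempty with rfl | hne
    · exact ⟨0, fun n _ y hy => by simp at hy⟩
    obtain ⟨α, hα, hαle⟩ := hA.exists_isLeast hne
    obtain ⟨β, hβ, hβle⟩ := hA.exists_isGreatest hne
    have hcont : Continuous (Subtype.val : unitInterval → ℝ) := continuous_subtype_val
    obtain ⟨p, hpφ, hp⟩ := exists_lt_of_eventually_nhds (hφI ϑ).1
      (hcont.continuousAt.eventually_const_lt (sub_lt_self (φ ϑ : ℝ) hε))
    obtain ⟨q, hqφ, hq⟩ := exists_gt_of_eventually_nhds (hφI ϑ).2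
      (hcont.continuousAt.eventually_lt_const (lt_add_of_pos_right (φ ϑ : ℝ) hε))
    have hpα := Tendsto.eventually_lt_const (hAI hα).1 (hlow ϑ hϑ p hpφ)
    have hβq := Tendsto.eventually_const_lt (hAI hβ).2 (hupp ϑ hϑ q hqφ)
    obtain ⟨N, hN⟩ := eventually_atTop.1 (hpα.and hβq)
    refine ⟨N, fun n hn y hy => ?_⟩
    obtain ⟨_, ⟨⟨ω, z⟩, ⟨rfl, hz⟩, rfl⟩, rfl⟩ := hy
    have h1 := strictMono_snd_iterate_skewProduct (S := S) hmono n (S.symm^[n] ϑ)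
      ((hN n hn).1.trans_le (hαle hz))
    have h2 := strictMono_snd_iterate_skewProduct (S := S) hmono n (S.symm^[n] ϑ)
      ((hβle hz).trans_lt (hN n hn).2)
    simp only [iterate_skewProduct_backward] at h1 h2
    exact ⟨hp.trans h1, lt_trans h2 hq⟩
  · intro _ _ _ hF
    exact ae_weakStarTendsto_empiricalMeasure hS hφm
      (by filter_upwards [hEae] with ϑ hϑ using hφn ϑ hϑ) hattr hF
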